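/- Let $b, c$ and $a_1, a_2$ be positive integers. For integers $a$ and $k\ge 0$ let $\binom{a}{k}$ denote the binomial coefficient, with the convention that it is $0$ unless $0\le k\le a$; an empty sum is $0$. Let $(c(p,q))_{p,q\ge 0}$ be any family of integers with $c(0,0)=1$. Then the following two rules are equivalent. (i) (The recurrence defining the coefficients of the greedy element at $(a_1,a_2)$ in the rank 2 cluster algebra $\mathcal{A}(b,c)$.) For every pair $(p,q)\in\mathbb{Z}_{\ge 0}^2$ with $(p,q)\ne(0,0)$, $$c(p,q)=\max\left(\sum_{k=1}^p(-1)^{k-1}c(p-k,q)\binom{a_2-cq+k-1}{k},\ \sum_{k=1}^q(-1)^{k-1}c(p,q-k)\binom{a_1-bp+k-1}{k}\right).$$ (ii) For every pair $(p,q)\in\mathbb{Z}_{\ge 0}^2$ with $(p,q)\ne(0,0)$, $$c(p,q)=\begin{cases}\displaystyle\sum_{k=1}^p(-1)^{k-1}c(p-k,q)\binom{a_2-cq+k-1}{k}, & \text{if } ca_1q\le ba_2p;\\[2ex] \displaystyle\sum_{k=1}^q(-1)^{k-1}c(p,q-k)\binom{a_1-bp+k-1}{k}, & \text{if } ca_1q\ge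 ba_2p,\end{cases}$$ where both formulas are required to hold when $ca_1q=ba_2p$. (As usual, $c$ denotes the fixed positive integer, and $c(p,q)$ the members of the family.) -/

import Mathlib

namespace Greedy

/-- The binomial coefficient `a choose k` for an integer `a` and a natural number `k`,
with the convention that it is zero unless `0 ≤ k ≤ a`. -/
def binom (a : ℤ) (k : ℕ) : ℤ :=
  if (k : ℤ) ≤ a then (a.toNat.choose k : ℤ) else 0

/-- The first alternating sum
`∑_{k=1}^p (-1)^(k-1) d(p-k,q) * binom (a₂ - c q + k - 1) k`. -/
def firstSum (c : ℕ) (a₂ : ℤ) (d : ℕ → ℕ → ℤ) (p q : ℕ) : ℤ :=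
  ∑ k ∈ Finset.Icc 1 p,
    (-1) ^ (k - 1) * d (p - k) q * binom (a₂ - (c : ℤ) * (q : ℤ) + (k : ℤ) - 1) k

/-- The second alternating sum
`∑_{k=1}^q (-1)^(k-1) d(p,q-k) * binom (a₁ - b p + k - 1) k`. -/
def secondSum (b : ℕ) (a₁ : ℤ) (d : ℕ → ℕ → ℤ) (p q : ℕ) : ℤ :=
  ∑ k ∈ Finset.Icc 1 q,
    (-1) ^ (k - 1) * d p (q - k) * binom (a₁ - (b : ℤ) * (p : ℤ) + (k : ℤ) - 1) k

/-- The recurrence defining the coefficients of a greedy element at `(a₁, a₂)`: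
each `d(p,q)` with `(p,q) ≠ (0,0)` is the maximum of the two sums. -/
def MaxRule (b c : ℕ) (a₁ a₂ : ℤ) (d : ℕ → ℕ → ℤ) : Prop :=
  ∀ p q : ℕ, (p, q) ≠ (0, 0) →
    d p q = max (firstSum c a₂ d p q) (secondSum b a₁ d p q)

/-- The linear rule: for `(p,q) ≠ (0,0)`, the coefficient `d(p,q)` is the first sum if
`c a₁ q ≤ b a₂ p` and the second sum if `c a₁ q ≥ b a₂ p` (so both, in case of equality). -/
def LinearRule (b c : ℕ) (a₁ a₂ : ℤ) (d : ℕ → ℕ → ℤ) : Prop :=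
  ∀ p q : ℕ, (p, q) ≠ (0, 0) →
    ((c : ℤ) * a₁ * (q : ℤ) ≤ (b : ℤ) * a₂ * (p : ℤ) → d p q = firstSum c a₂ d p q) ∧
    ((b : ℤ) * a₂ * (p : ℤ) ≤ (c : ℤ) * a₁ * (q : ℤ) → d p q = secondSum b a₁ d p q)

end Greedy

/-! Each rule determines the family from its value at `(0,0)`, by induction on `p + q`, so it
suffices to exhibit one family obeying both (`exists_linearRule_maxRule`). It is `compatCount`: on a
balanced cyclic word with `a₁` horizontal and `a₂` vertical edges, it counts compatible pairs of a
`q`-set `S` of horizontal and a `p`-set `T` of vertical edges.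

Fix `q` with `c q < a₂`. Compatibility constrains only the part of `T` in the shadow of `S`, and
exactly `a₂ - c q` vertical edges lie outside (`card_sdiff_shadow`). The generating function in `p`
is thus a multiple of `(1 + X) ^ (a₂ - c q)`, and dividing by this power shows that the count minus
the first sum is the number of compatible pairs with `T` inside the shadow (`firstSum_compatCount`).
This is nonnegative, and it vanishes if `c a₁ q ≤ b a₂ p`, because balancedness forces `b a₂ p < c
a₁ q` for such pairs with `S` nonempty (`Compatible.card_mul_lt_of_drift_nonpos`). If `a₂ ≤ c q`,
the first sum is zero and similar inequalities show that there are no pairs on that side of the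
diagonal.

Reversing the word exchanges the two kinds of edges and gives the second sum. Both sums are
therefore lower bounds, and the one selected by the linear rule is attained. -/

namespace Greedy

/-! ### Periodic walks and shadows. -/

section CyclicWord

open Finset

variable {N : ℕ}

/-- The indicator on `ℤ` of the `N`-periodic set with residues `S`. -/
def ind (S : Finset (ZMod N)) (l : ℤ) : ℤ := if (l : ZMod N) ∈ S then 1 else 0

/-- The signed number of integers between `0` and `n` with residue in `S`. -/
noncomputable def cnt (S : Finset (ZMod N)) (n : ℤ) : ℤ :=
  ∑ l ∈ Ico 0 n, ind S l - ∑ l ∈ Ico n 0, ind S l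

lemma ind_of_mem {S : Finset (ZMod N)} {l : ℤ} (h : (l : ZMod N) ∈ S) : ind S l = 1 := if_pos h

lemma ind_of_notMem {S : Finset (ZMod N)} {l : ℤ} (h : (l : ZMod N) ∉ S) : ind S l = 0 := if_neg h

lemma ind_nonneg (S : Finset (ZMod N)) (l : ℤ) : 0 ≤ ind S l := by
  unfold ind; split_ifs <;> norm_num

lemma cnt_succ (S : Finset (ZMod N)) (n : ℤ) : cnt S (n + 1) = cnt S n + ind S n := by
  unfold cnt
  rcases le_or_gt 0 n with h | h
  · rw [Ico_eq_empty (by omega : ¬ n + 1 < 0), Ico_eq_empty (by omega : ¬ n < 0),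
      ← insert_Ico_right_eq_Ico_add_one h, sum_insert (by simp)]
    simp [add_comm]
  · rw [Ico_eq_empty (by omega : ¬ 0 < n + 1), Ico_eq_empty (by omega : ¬ 0 < n),
      ← insert_Ico_add_one_left_eq_Ico h, sum_insert (by simp)]
    simp

lemma cnt_zero (S : Finset (ZMod N)) : cnt S 0 = 0 := by simp [cnt]

/-- A function on `ℤ` is determined by its differences and its value at `0`. -/
lemma eq_of_succ_eq {f g : ℤ → ℤ} (h0 : f 0 = g 0)
    (h : ∀ n, f (n + 1) - f n = g (n + 1) - g n) (n : ℤ) : f n = g n := by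
  induction n using Int.induction_on with
  | zero => exact h0
  | succ n ih => linarith [h n]
  | pred n ih => have := h (-(n : ℤ) - 1); simp only [sub_add_cancel] at this; linarith

/-- The walk which goes up by `w` at the elements of `S` and down by `1` at those of `T`. -/
noncomputable def height (w : ℕ) (S T : Finset (ZMod N)) (n : ℤ) : ℤ := w * cnt S n - cnt T n

lemma height_succ (w : ℕ) (S T : Finset (ZMod N)) (n : ℤ) :
    height w S T (n + 1) = height w S T n + w * ind S n - ind T n := by
  unfold height; rw [cnt_succ, cnt_succ]; ring

/-- The position `j` lies in the shadow cast to the right from `i`. -/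
def Covers (w : ℕ) (S T : Finset (ZMod N)) (i j : ℤ) : Prop :=
  ∀ m, i < m → m ≤ j → height w S T i < height w S T m

/-- The position `i` lies in the shadow cast to the left from `j`. -/
def CoversLeft (w : ℕ) (S T : Finset (ZMod N)) (i j : ℤ) : Prop :=
  ∀ m, i < m → m ≤ j → height w S T m < height w S T (j + 1)

/-- Compatibility of a set `S` of horizontal edges with a set `T` of vertical edges: no two
edges lie in the shadow of each other. -/
def Compatible (b c : ℕ) (H V S T : Finset (ZMod N)) : Prop :=
  ∀ i j : ℤ, i < j → ¬ (Covers c S V i j ∧ CoversLeft b T H i j)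

open Classical in
/-- The vertical edges in the shadow of `S`. -/
noncomputable def shadow (c : ℕ) (V S : Finset (ZMod N)) : Finset (ZMod N) :=
  {x ∈ V | ∃ i j : ℤ, i < j ∧ (j : ZMod N) = x ∧ Covers c S V i j}

lemma shadow_subset (c : ℕ) (V S : Finset (ZMod N)) : shadow c V S ⊆ V := by
  classical exact filter_subset _ _

lemma exists_add_mul_period {i j : ℤ} (h : (i : ZMod N) = j) : ∃ t : ℤ, j = i + t * N := by
  rw [ZMod.intCast_eq_intCast_iff_dvd_sub] at h
  obtain ⟨t, ht⟩ := h
  exact ⟨t, by linarith⟩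

lemma ind_add_period (S : Finset (ZMod N)) (n : ℤ) : ind S (n + N) = ind S n := by
  simp [ind]

/-- If the shadow to the right of `i` reaches up to `r`, compatibility bounds the walk of `T`. -/
lemma Compatible.height_le {b c : ℕ} {H V S T : Finset (ZMod N)} (hC : Compatible b c H V S T)
    {i r : ℤ} (hr : ∀ m, i < m → m < r → height c S V i < height c S V m) (n : ℕ)
    (hn : i + 1 + n ≤ r) : height b T H (i + 1 + n) ≤ height b T H (i + 1) := by
  induction n using Nat.strong_induction_on with
  | _ n ih =>
    rcases Nat.eq_zero_or_pos n with rfl | hpos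
    · simp
    have hnot := hC i (i + n) (by omega)
    simp only [not_and, CoversLeft, not_forall, not_lt] at hnot
    -- The shadow to the left fails, which yields an earlier point at least as high; repeating this
    -- leads back to `i + 1`.
    obtain ⟨m, hm, hmj, hle⟩ := hnot fun m hm hmj => hr m hm (by omega)
    have := ih (m - (i + 1)).toNat (by omega) (by omega)
    rw [show i + 1 + ((m - (i + 1)).toNat : ℤ) = m by omega] at this
    rw [show i + 1 + (n : ℤ) = i + n + 1 by ring]
    exact hle.trans this

variable [NeZero N]

lemma cnt_period (S : Finset (ZMod N)) : cnt S N = #S := by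
  have h1 : cnt S N = ∑ l ∈ Ico (0 : ℤ) N, ind S l := by
    unfold cnt
    rw [Ico_eq_empty (by omega : ¬ (N : ℤ) < 0)]
    simp
  have h2 : (#S : ℤ) = ∑ x : ZMod N, if x ∈ S then (1 : ℤ) else 0 := by
    simp
  rw [h1, h2]
  refine sum_nbij' (fun l => (l : ZMod N)) (fun x => (x.val : ℤ)) ?_ ?_ ?_ ?_ ?_
  · simp
  · intro x _
    have := ZMod.val_lt x
    simp only [mem_Ico]
    omega
  · intro l hl
    rw [mem_Ico] at hl
    simp only [ZMod.val_intCast]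
    exact Int.emod_eq_of_lt hl.1 hl.2
  · intro x _
    simp
  · intro l _
    rfl

lemma cnt_add_period (S : Finset (ZMod N)) (n : ℤ) : cnt S (n + N) = cnt S n + #S := by
  refine eq_of_succ_eq (f := fun n => cnt S (n + N)) (g := fun n => cnt S n + #S) ?_ ?_ n
  · simp [cnt_zero, cnt_period]
  · intro n
    have h1 := cnt_succ S (n + N)
    have h2 := cnt_succ S n
    rw [ind_add_period] at h1
    rw [show n + 1 + (N : ℤ) = n + N + 1 by ring]
    linarith

lemma cnt_add_mul_period (S : Finset (ZMod N)) (n t : ℤ) :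
    cnt S (n + t * N) = cnt S n + t * #S := by
  refine eq_of_succ_eq (f := fun t => cnt S (n + t * N)) (g := fun t => cnt S n + t * #S) ?_ ?_ t
  · simp
  · intro t
    have := cnt_add_period S (n + t * N)
    rw [show n + (t + 1) * (N : ℤ) = n + t * N + N by ring]
    linarith

lemma height_add_mul_period (w : ℕ) (S T : Finset (ZMod N)) (n t : ℤ) :
    height w S T (n + t * N) = height w S T n + t * (w * #S - #T) := by
  unfold height; rw [cnt_add_mul_period, cnt_add_mul_period]; ring

lemma height_add_period (w : ℕ) (S T : Finset (ZMod N)) (n : ℤ) :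
    height w S T (n + N) = height w S T n + (w * #S - #T) := by
  simpa using height_add_mul_period w S T n 1

/-- Inside `V`, the shadow consists of the positions that are not weak record lows. -/
lemma mem_shadow_iff {c : ℕ} {V S : Finset (ZMod N)} {j : ℤ} (hj : (j : ZMod N) ∈ V) :
    (j : ZMod N) ∈ shadow c V S ↔ ∃ i < j, height c S V i < height c S V j := by
  classical
  constructor
  · intro h
    obtain ⟨-, i, j', hij, hjj, hc⟩ := mem_filter.1 h
    obtain ⟨t, rfl⟩ := exists_add_mul_period hjj
    refine ⟨i + t * N, by linarith, ?_⟩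
    rw [height_add_mul_period, height_add_mul_period]
    linarith [hc j' hij le_rfl]
  · rintro ⟨i, hij, hlt⟩
    -- The last position lower than `j` works: everything strictly between is at least as high as
    -- `j`.
    obtain ⟨k, ⟨hk1, hk2⟩, hk⟩ := Int.exists_greatest_of_bdd
      (P := fun i => i < j ∧ height c S V i < height c S V j) ⟨j, fun z hz => hz.1.le⟩
      ⟨i, hij, hlt⟩
    refine mem_filter.2 ⟨hj, k, j, hk1, rfl, fun m hm hmj => ?_⟩
    rcases hmj.eq_or_lt with rfl | hmj
    · exact hk2
    · by_contra hcon
      have := hk m ⟨hmj, by linarith⟩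
      omega

/-- Compatibility is tested only on stretches covered from some `i`, and there every edge of `T`
lies above `i`, hence in the shadow. Edges outside the shadow are never seen. -/
lemma compatible_inter_shadow (b c : ℕ) (H : Finset (ZMod N)) {V S T : Finset (ZMod N)}
    (hT : T ⊆ V) :
    Compatible b c H V S (T ∩ shadow c V S) ↔ Compatible b c H V S T := by
  classical
  refine forall_congr' fun i => forall_congr' fun j => imp_congr_right fun hij =>
    not_congr <| and_congr_right fun hc => ?_
  have key : ∀ m, i < m → m ≤ j + 1 →
      height b (T ∩ shadow c V S) H m - height b (T ∩ shadow c V S) H (i + 1)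
        = height b T H m - height b T H (i + 1) := by
    intro m hm
    induction m, (show i + 1 ≤ m by omega) using Int.leInduction with
    | base => simp
    | succ m hm' ih =>
      intro hmj
      have := ih (by omega) (by omega)
      rw [height_succ _ _ _ m, height_succ _ _ _ m]
      have : ind (T ∩ shadow c V S) m = ind T m := by
        by_cases h : (m : ZMod N) ∈ T
        · have h2 : (m : ZMod N) ∈ shadow c V S :=
            (mem_shadow_iff (hT h)).2 ⟨i, by omega, hc m (by omega) (by omega)⟩
          rw [ind_of_mem h, ind_of_mem (mem_inter.2 ⟨h, h2⟩)]
        · rw [ind_of_notMem h, ind_of_notMem fun h' => h (mem_inter.1 h').1]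
      rw [this]
      linarith
  refine forall_congr' fun m => forall_congr' fun hm => forall_congr' fun hmj => ?_
  have h1 := key m hm (by omega)
  have h2 := key (j + 1) (by omega) le_rfl
  constructor <;> intro h <;> linarith

/-- For nonpositive drift, the walk attains its minimum on every left half-line. -/
lemma exists_height_min {c : ℕ} {V S : Finset (ZMod N)} (hs : c * #S ≤ #V) (j : ℤ) :
    ∃ k ≤ j, ∀ i ≤ j, height c S V k ≤ height c S V i := by
  have hN : 0 < N := Nat.pos_of_neZero N
  obtain ⟨k, hk, hmin⟩ := exists_min_image (Ioc (j - N) j) (height c S V)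
    ⟨j, by simp [hN]⟩
  refine ⟨k, (mem_Ioc.1 hk).2, fun i hi => ?_⟩
  -- Shifting `i` right by `t` periods lands in the window ending at `j` and does not raise the
  -- walk.
  set t := (j - i) / N with ht
  have ht0 : 0 ≤ t := Int.ediv_nonneg (by omega) (by omega)
  have h1 : (j - i) % N + N * t = j - i := Int.emod_add_mul_ediv _ _
  have h2 := Int.emod_nonneg (j - i) (show (N : ℤ) ≠ 0 by omega)
  have h3 := Int.emod_lt_of_pos (j - i) (show (0 : ℤ) < N by omega)
  have h4 := hmin (i + t * N) (mem_Ioc.2 ⟨by linarith, by linarith⟩)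
  rw [height_add_mul_period] at h4
  have hs' : (c * #S : ℤ) - #V ≤ 0 := by
    have : (c * #S : ℤ) ≤ #V := by exact_mod_cast hs
    linarith
  nlinarith [mul_nonneg ht0 (neg_nonneg.2 hs')]

/-- The running minimum `h (κ j)` drops by one exactly at the vertical edges outside the shadow, and
over a period it drops by minus the drift. -/
lemma card_sdiff_shadow {c : ℕ} {V S : Finset (ZMod N)} (hdisj : Disjoint S V)
    (hs : c * #S ≤ #V) : #(V \ shadow c V S) = #V - c * #S := by
  classical
  choose κ hκ hmin using exists_height_min (c := c) hs
  set h := height c S V with hh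
  have hM : ∀ j, h (κ j) - h (κ (j + 1)) = ind (V \ shadow c V S) j := by
    intro j
    have hsucc : h (j + 1) = h j + c * ind S j - ind V j := height_succ c S V j
    have h1 : h (κ (j + 1)) ≤ h (κ j) := hmin _ _ (by have := hκ j; omega)
    have h2 : h (κ j) ≤ h j := hmin _ _ le_rfl
    have h3 : h (κ (j + 1)) ≤ h (j + 1) := hmin _ _ le_rfl
    have h4 : h (κ (j + 1)) = h (j + 1) ∨ h (κ j) ≤ h (κ (j + 1)) := by
      rcases (hκ (j + 1)).eq_or_lt with e | e
      · left; rw [e]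
      · right; exact hmin _ _ (by omega)
    by_cases hV : (j : ZMod N) ∈ V
    · have hS : (j : ZMod N) ∉ S := fun hS => disjoint_left.1 hdisj hS hV
      rw [ind_of_mem hV, ind_of_notMem hS] at hsucc
      by_cases hm : (j : ZMod N) ∈ shadow c V S
      · rw [ind_of_notMem (by simp [hm])]
        obtain ⟨i, hij, hi⟩ := (mem_shadow_iff hV).1 hm
        have := hmin j i hij.le
        rcases h4 with h4 | h4 <;> linarith
      · rw [ind_of_mem (by simp [hm, hV])]
        have h5 : h j ≤ h (κ j) := by
          by_contra hcon
          refine hm ((mem_shadow_iff hV).2 ⟨κ j, ?_, by linarith⟩)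
          refine lt_of_le_of_ne (hκ j) fun e => ?_
          rw [e] at hcon
          exact hcon le_rfl
        rcases h4 with h4 | h4 <;> linarith
    · rw [ind_of_notMem (by simp [hV])]
      rw [ind_of_notMem hV] at hsucc
      have : (0 : ℤ) ≤ c * ind S j := mul_nonneg (by positivity) (ind_nonneg S j)
      rcases h4 with h4 | h4 <;> linarith
  have hsum : h (κ 0) - h (κ N) = #(V \ shadow c V S) := by
    rw [← cnt_period]
    refine eq_of_succ_eq (f := fun n => h (κ 0) - h (κ n)) (by simp [cnt_zero]) (fun n => ?_) N
    have := hM n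
    rw [cnt_succ]
    linarith
  have hper : h (κ N) = h (κ 0) + (c * #S - #V) := by
    apply le_antisymm
    · have := hmin N (κ 0 + N) (by have := hκ 0; omega)
      rwa [hh, height_add_period, ← hh] at this
    · have := hmin 0 (κ N + (-1) * N) (by have := hκ N; omega)
      rw [hh, height_add_mul_period, ← hh] at this
      linarith
  have : (#(V \ shadow c V S) : ℤ) + c * #S = #V := by linarith
  have : #(V \ shadow c V S) + c * #S = #V := by exact_mod_cast this
  omega

end CyclicWord

/-! ### Weight inequalities and the splitting of fibers. -/

section CompatiblePairs

open Finset

variable {N : ℕ}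

/-- The counts of horizontal and vertical edges in every stretch from a horizontal to a vertical
edge are nearly proportional to the total counts. -/
def Balanced (H V : Finset (ZMod N)) : Prop :=
  ∀ i j : ℤ, i < j → (i : ZMod N) ∈ H → (j : ZMod N) ∈ V →
    #V * (cnt H (j + 1) - cnt H i - 1) < #H * (cnt V (j + 1) - cnt V i) ∧
    #H * (cnt V (j + 1) - cnt V i - 1) < #V * (cnt H (j + 1) - cnt H i)

/-- The edges with positive weight are compensated by those with negative weight on any stretch
between two weak record lows of the walk of `S`. -/
lemma Compatible.weight_le {b c : ℕ} (hc : 0 < c) {H V S T : Finset (ZMod N)} [NeZero N]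
    (hHV : Disjoint H V) (hbal : Balanced H V) (hSH : S ⊆ H) (hTS : T ⊆ shadow c V S)
    (hC : Compatible b c H V S T) (n : ℕ) (k : ℤ)
    (hk : ∀ i ≤ k, height c S V k ≤ height c S V i)
    (hkn : ∀ i ≤ k + n, height c S V (k + n) ≤ height c S V i) :
    (b * #V * (cnt T (k + n) - cnt T k) ≤ c * #H * (cnt S (k + n) - cnt S k)) ∧
    (0 < cnt S (k + n) - cnt S k →
      b * #V * (cnt T (k + n) - cnt T k) < c * #H * (cnt S (k + n) - cnt S k)) := by
  have hTV : T ⊆ V := hTS.trans (shadow_subset c V S)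
  induction n using Nat.strong_induction_on generalizing k with
  | _ n ih =>
    rcases Nat.eq_zero_or_pos n with rfl | hpos
    · simp
    by_cases hkS : (k : ZMod N) ∈ S
    · have hkH := hSH hkS
      have hkV : (k : ZMod N) ∉ V := disjoint_left.1 hHV hkH
      have hkT : (k : ZMod N) ∉ T := fun h => hkV (hTV h)
      -- `r` is the first return to the level of `k`. Compatibility bounds `T` on the excursion from
      -- `k` to `r`, balancedness compares the edge counts there, and induction handles the rest.
      obtain ⟨r, ⟨hkr, hr⟩, hmin⟩ := Int.exists_least_of_bdd
        (P := fun m => k < m ∧ height c S V m ≤ height c S V k) ⟨k, fun z hz => hz.1.le⟩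
        ⟨k + n, by omega, hkn k (by omega)⟩
      have hrn : r ≤ k + n := hmin _ ⟨by omega, hkn k (by omega)⟩
      have hlt : ∀ m, k < m → m < r → height c S V k < height c S V m := by
        intro m hm hmr
        by_contra hcon
        have := hmin m ⟨hm, not_lt.1 hcon⟩
        omega
      have hk1 : height c S V k < height c S V (k + 1) := by
        rw [height_succ, ind_of_mem hkS, ind_of_notMem hkV]
        have : (0 : ℤ) < c := by exact_mod_cast hc
        linarith
      have hr1 : k + 1 < r := by
        refine lt_of_le_of_ne (by omega) fun e => ?_
        rw [← e] at hr
        exact absurd hk1 (not_lt.2 hr)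
      have hprev := hlt (r - 1) (by omega) (by omega)
      have hstep := height_succ c S V (r - 1)
      rw [sub_add_cancel] at hstep
      have hcS : (0 : ℤ) ≤ c * ind S (r - 1) := mul_nonneg (by positivity) (ind_nonneg _ _)
      have hrV : ((r - 1 : ℤ) : ZMod N) ∈ V := by
        by_contra h
        rw [ind_of_notMem h] at hstep
        linarith
      rw [ind_of_mem hrV] at hstep
      have hreq : height c S V r = height c S V k := le_antisymm hr (by linarith)
      have hG := hC.height_le hlt (r - (k + 1)).toNat (by omega)
      rw [show k + 1 + ((r - (k + 1)).toNat : ℤ) = r by omega, height_succ, ind_of_mem hkH,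
        ind_of_notMem hkT] at hG
      have hb := (hbal k (r - 1) (by omega) hkH hrV).1
      rw [sub_add_cancel] at hb
      obtain ⟨m, rfl⟩ : ∃ m : ℕ, r = k + n - m := ⟨(k + n - r).toNat, by omega⟩
      have hrec : ∀ i ≤ k + n - m, height c S V (k + n - m) ≤ height c S V i := by
        intro i hi
        rcases le_or_gt i k with h | h
        · rw [hreq]; exact hk i h
        rcases hi.eq_or_lt with rfl | hi
        · exact le_rfl
        · rw [hreq]; exact (hlt i h hi).le
      have hih := (ih m (by omega) (k + n - m) hrec (by simpa using hkn)).1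
      rw [sub_add_cancel] at hih
      simp only [height] at hreq hG
      have hlt' : b * #V * (cnt T (k + n - m) - cnt T k)
          < c * #H * (cnt S (k + n - m) - cnt S k) := by
        calc (b * #V * (cnt T (k + n - m) - cnt T k) : ℤ)
            = #V * (b * (cnt T (k + n - m) - cnt T k)) := by ring
          _ ≤ #V * (cnt H (k + n - m) - cnt H k - 1) :=
              mul_le_mul_of_nonneg_left (by linarith) (by positivity)
          _ < #H * (cnt V (k + n - m) - cnt V k) := hb
          _ = #H * (c * (cnt S (k + n - m) - cnt S k)) := by congr 1; linarith
          _ = _ := by ring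
      exact ⟨by linarith, fun _ => by linarith⟩
    -- A weak record low is outside the shadow, so this step carries no weight.
    · have hkT : (k : ZMod N) ∉ T := by
        intro h
        obtain ⟨i, hi, hlt⟩ := (mem_shadow_iff (hTV h)).1 (hTS h)
        exact absurd (hk i hi.le) (not_le.2 hlt)
      obtain ⟨m, rfl⟩ := Nat.exists_eq_succ_of_ne_zero hpos.ne'
      have hdown : height c S V (k + 1) ≤ height c S V k := by
        rw [height_succ, ind_of_notMem hkS]
        linarith [ind_nonneg V k]
      have hrec : ∀ i ≤ k + 1, height c S V (k + 1) ≤ height c S V i := by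
        intro i hi
        rcases hi.eq_or_lt with rfl | hi
        · exact le_rfl
        · exact hdown.trans (hk i (by omega))
      have e : k + 1 + (m : ℤ) = k + (m.succ : ℕ) := by push_cast; ring
      have := ih m (by omega) (k + 1) hrec (by rw [e]; exact hkn)
      rw [e, cnt_succ, cnt_succ, ind_of_notMem hkS, ind_of_notMem hkT] at this
      simpa using this

/-- Nonpositive drift supplies a weak record low whose translate by a period is another, so
`Compatible.weight_le` applies to a full period. -/
lemma Compatible.card_mul_lt_of_drift_nonpos {b c : ℕ} (hc : 0 < c) {H V S T : Finset (ZMod N)}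
    [NeZero N] (hHV : Disjoint H V) (hbal : Balanced H V) (hSH : S ⊆ H) (hS : S.Nonempty)
    (hTS : T ⊆ shadow c V S) (hC : Compatible b c H V S T) (hs : c * #S ≤ #V) :
    b * #V * #T < c * #H * #S := by
  obtain ⟨k, -, hk⟩ : ∃ k, True ∧ ∀ i ≤ k, height c S V k ≤ height c S V i := by
    obtain ⟨k, hk, hmin⟩ := exists_height_min (c := c) (S := S) (V := V) hs 0
    exact ⟨k, trivial, fun i hi => hmin i (hi.trans hk)⟩
  have hs' : (c * #S : ℤ) ≤ #V := by exact_mod_cast hs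
  have := (hC.weight_le hc hHV hbal hSH hTS N k hk (fun i hi => by
    have h1 := hk (i + (-1) * N) (by linarith)
    rw [height_add_mul_period] at h1
    rw [height_add_period]
    linarith)).2
  rw [cnt_add_period, cnt_add_period, add_sub_cancel_left, add_sub_cancel_left] at this
  exact_mod_cast this (by exact_mod_cast hS.card_pos)

/-- With positive drift, the shadow cast from the last minimum in a period covers a whole period, so
the walk of `T` cannot gain height around it. -/
lemma Compatible.card_mul_lt_of_drift_pos {b c : ℕ} {H V S T : Finset (ZMod N)} [NeZero N]
    (hHV : Disjoint H V) (hSH : S ⊆ H) (hTV : T ⊆ V) (hC : Compatible b c H V S T)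
    (hs : #V < c * #S) : b * #T < #H := by
  have hN : 0 < N := Nat.pos_of_neZero N
  have hs' : (#V : ℤ) < c * #S := by exact_mod_cast hs
  obtain ⟨i, ⟨hi0, hiN, himin⟩, hlast⟩ := Int.exists_greatest_of_bdd
    (P := fun i => 0 ≤ i ∧ i < N ∧ ∀ k : ℤ, 0 ≤ k → k < N → height c S V i ≤ height c S V k)
    ⟨N, fun z hz => hz.2.1.le⟩ (by
      obtain ⟨i, hi, hmin⟩ := exists_min_image (Ico (0 : ℤ) N) (height c S V) ⟨0, by simp [hN]⟩
      rw [mem_Ico] at hi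
      exact ⟨i, hi.1, hi.2, fun k h0 h1 => hmin k (mem_Ico.2 ⟨h0, h1⟩)⟩)
  have hlt : ∀ m, i < m → m ≤ i + N → height c S V i < height c S V m := by
    intro m hm hmN
    rcases lt_or_ge m (N : ℤ) with h | h
    · refine lt_of_le_of_ne (himin m (by omega) h) fun e => ?_
      have := hlast m ⟨by omega, h, fun k h0 h1 => e ▸ himin k h0 h1⟩
      omega
    · have h1 := height_add_period c S V (m - N)
      rw [sub_add_cancel] at h1
      have : height c S V i ≤ height c S V (m - N) := by
        rcases hmN.eq_or_lt with rfl | hlt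
        · simp
        · exact himin _ (by omega) (by omega)
      linarith
  have hiS : (i : ZMod N) ∈ S := by
    by_contra h
    have := hlt (i + 1) (by omega) (by omega)
    rw [height_succ, ind_of_notMem h] at this
    linarith [ind_nonneg V i]
  have hiT : (i : ZMod N) ∉ T := fun h => disjoint_left.1 hHV (hSH hiS) (hTV h)
  have hG := hC.height_le (r := i + N) (fun m h1 h2 => hlt m h1 h2.le) (N - 1) (by omega)
  -- The bound starts at `i + 1`, one below the height at `i`; this makes the inequality strict.
  rw [show i + 1 + ((N - 1 : ℕ) : ℤ) = i + N by omega, height_add_period, height_succ,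
    ind_of_mem (hSH hiS), ind_of_notMem hiT] at hG
  have : (b * #T : ℤ) < #H := by linarith
  exact_mod_cast this

open Classical in
/-- The number of compatible pairs with `q` horizontal and `p` vertical edges. -/
noncomputable def compatCount (b c : ℕ) (H V : Finset (ZMod N)) (p q : ℕ) : ℕ :=
  #{x ∈ H.powersetCard q ×ˢ V.powersetCard p | Compatible b c H V x.1 x.2}

open Classical in
/-- The number of sets of `p` edges from `V` which are compatible with `S` and lie in `U`. -/
noncomputable def fiberCount (b c : ℕ) (H V S U : Finset (ZMod N)) (p : ℕ) : ℕ :=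
  #{T ∈ U.powersetCard p | Compatible b c H V S T}

lemma compatCount_eq_sum (b c : ℕ) (H V : Finset (ZMod N)) (p q : ℕ) :
    compatCount b c H V p q = ∑ S ∈ H.powersetCard q, fiberCount b c H V S V p := by
  classical
  simp only [compatCount, fiberCount, card_filter, sum_product]

/-- Split `T` into its part in the shadow, which alone decides compatibility, and a free part
outside. -/
lemma fiberCount_eq_sum [NeZero N] (b c : ℕ) (H V S : Finset (ZMod N)) (p : ℕ) :
    fiberCount b c H V S V p = ∑ x ∈ HasAntidiagonal.antidiagonal p,
      fiberCount b c H V S (shadow c V S) x.1 * (#(V \ shadow c V S)).choose x.2 := by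
  classical
  set U := shadow c V S with hU
  have hUV : U ⊆ V := shadow_subset c V S
  simp_rw [← card_powersetCard, fiberCount, ← card_product]
  rw [← card_sigma]
  refine card_nbij (fun T => ⟨(#(T ∩ U), #(T \ U)), (T ∩ U, T \ U)⟩) ?_ ?_ ?_
  · intro T hT
    obtain ⟨hT, hC⟩ := mem_filter.1 hT
    obtain ⟨hTV, hTp⟩ := mem_powersetCard.1 hT
    simp only [mem_coe, mem_sigma, HasAntidiagonal.mem_antidiagonal, mem_product, mem_filter,
      mem_powersetCard]
    exact ⟨by rw [card_inter_add_card_sdiff, hTp], ⟨⟨inter_subset_right, trivial⟩,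
      (compatible_inter_shadow b c H hTV).2 hC⟩, sdiff_subset_sdiff hTV le_rfl, trivial⟩
  · intro T _ T' _ h
    simp only [Sigma.mk.injEq, Prod.mk.injEq] at h
    obtain ⟨h1, h2⟩ := Prod.ext_iff.1 (eq_of_heq h.2)
    simp only at h1 h2
    rw [← sdiff_union_inter T U, ← sdiff_union_inter T' U, h1, h2]
  · rintro ⟨⟨j, l⟩, ⟨X, Y⟩⟩ h
    simp only [coe_sigma, Set.mem_sigma_iff, mem_coe, HasAntidiagonal.mem_antidiagonal, mem_product, mem_filter,
      mem_powersetCard] at h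
    obtain ⟨hjl, ⟨⟨hX, rfl⟩, hC⟩, hY, rfl⟩ := h
    have hdisj : Disjoint Y U := disjoint_of_subset_left hY sdiff_disjoint
    have h1 : (X ∪ Y) ∩ U = X := by
      rw [union_inter_distrib_right, disjoint_iff_inter_eq_empty.1 hdisj, union_empty,
        inter_eq_left.2 hX]
    have h2 : (X ∪ Y) \ U = Y := by
      rw [union_sdiff_distrib, sdiff_eq_empty_iff_subset.2 hX, empty_union,
        sdiff_eq_self_of_disjoint hdisj]
    have hsub : X ∪ Y ⊆ V := union_subset (hX.trans hUV) (hY.trans sdiff_subset)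
    refine ⟨X ∪ Y, ?_, ?_⟩
    · simp only [mem_coe, mem_filter, mem_powersetCard]
      refine ⟨⟨hsub, ?_⟩, ?_⟩
      · rw [card_union_of_disjoint (disjoint_of_subset_left hX hdisj.symm), hjl]
      · rw [← compatible_inter_shadow b c H hsub, ← hU, h1]
        exact hC
    · simp only [h1, h2]

end CompatiblePairs

/-! ### Reversal symmetry between horizontal and vertical edges. -/

section Reversal

open Finset

variable {N : ℕ}

/-- The set of residues obtained by reversing the cyclic word. -/
def rev (S : Finset (ZMod N)) : Finset (ZMod N) := S.map (Equiv.subLeft (-1)).toEmbedding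

lemma mem_rev {S : Finset (ZMod N)} {x : ZMod N} : x ∈ rev S ↔ -1 - x ∈ S := by
  simp only [rev, mem_map_equiv, Equiv.subLeft_symm_apply]
  rw [show -x + -1 = -1 - x by ring]

lemma card_rev (S : Finset (ZMod N)) : #(rev S) = #S := card_map _

lemma rev_rev (S : Finset (ZMod N)) : rev (rev S) = S := by
  ext x; simp [mem_rev]

lemma rev_mono {S T : Finset (ZMod N)} (h : S ⊆ T) : rev S ⊆ rev T := map_subset_map.2 h

/-- An edge `l` joins the points `l` and `l + 1`, so negating points sends it to the edge `-1 - l`.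
-/
lemma cnt_rev (S : Finset (ZMod N)) (n : ℤ) : cnt (rev S) n = - cnt S (-n) := by
  refine eq_of_succ_eq (f := cnt (rev S)) (g := fun n => - cnt S (-n)) (by simp [cnt_zero])
    (fun n => ?_) n
  have h := cnt_succ S (-n - 1)
  have h2 : ind (rev S) n = ind S (-n - 1) := by
    simp only [ind, mem_rev]
    rw [show (-1 - (n : ZMod N)) = ((-n - 1 : ℤ) : ZMod N) by push_cast; ring]
  rw [sub_add_cancel] at h
  rw [cnt_succ, h2, show -(n + 1) = -n - 1 by ring]
  linarith

lemma height_rev (w : ℕ) (S T : Finset (ZMod N)) (n : ℤ) :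
    height w (rev S) (rev T) n = - height w S T (-n) := by
  simp only [height, cnt_rev]; ring

lemma Compatible.rev {b c : ℕ} {H V S T : Finset (ZMod N)} (hC : Compatible b c H V S T) :
    Compatible c b (rev V) (rev H) (rev T) (rev S) := by
  rintro i j hij ⟨h1, h2⟩
  refine hC (-1 - j) (-1 - i) (by omega) ⟨fun m hm hmj => ?_, fun m hm hmj => ?_⟩
  · have := h2 (-m) (by omega) (by omega)
    rw [height_rev, height_rev, neg_neg] at this
    rw [show -1 - j = -(j + 1) by ring]
    linarith
  · have := h1 (-m) (by omega) (by omega)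
    rw [height_rev, height_rev, neg_neg] at this
    rw [show -1 - i + 1 = -i by ring]
    linarith

lemma compatCount_rev (b c : ℕ) (H V : Finset (ZMod N)) (p q : ℕ) :
    compatCount c b (rev V) (rev H) q p = compatCount b c H V p q := by
  classical
  refine card_nbij' (fun x => (rev x.2, rev x.1)) (fun x => (rev x.2, rev x.1)) ?_ ?_ ?_ ?_
  · rintro ⟨X, Y⟩ h
    simp only [mem_coe, mem_filter, mem_product, mem_powersetCard] at h ⊢
    have h1 := rev_mono h.1.1.1
    have h2 := rev_mono h.1.2.1
    have h3 := h.2.rev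
    rw [rev_rev] at h1 h2
    rw [rev_rev, rev_rev] at h3
    exact ⟨⟨⟨h2, by rw [card_rev, h.1.2.2]⟩, h1, by rw [card_rev, h.1.1.2]⟩, h3⟩
  · rintro ⟨X, Y⟩ h
    simp only [mem_coe, mem_filter, mem_product, mem_powersetCard] at h ⊢
    exact ⟨⟨⟨rev_mono h.1.2.1, by rw [card_rev, h.1.2.2]⟩, rev_mono h.1.1.1,
      by rw [card_rev, h.1.1.2]⟩, h.2.rev⟩
  · intro x _; simp [rev_rev]
  · intro x _; simp [rev_rev]

lemma Balanced.rev {H V : Finset (ZMod N)} (h : Balanced H V) : Balanced (rev V) (rev H) := by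
  intro i j hij hi hj
  have hi' : ((-1 - i : ℤ) : ZMod N) ∈ V := by push_cast; exact mem_rev.1 hi
  have hj' : ((-1 - j : ℤ) : ZMod N) ∈ H := by push_cast; exact mem_rev.1 hj
  obtain ⟨h1, h2⟩ := h (-1 - j) (-1 - i) (by omega) hj' hi'
  rw [show -1 - i + 1 = -i by ring, show -1 - j = -(j + 1) by ring] at h1 h2
  simp only [card_rev, cnt_rev]
  constructor <;> linarith

lemma disjoint_rev {H V : Finset (ZMod N)} (h : Disjoint H V) : Disjoint (rev V) (rev H) :=
  (disjoint_map _).2 h.symm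

end Reversal

/-! ### Generating functions and the two sums. -/

section Recurrence

open Finset

/-- In power series, `f = g * (1 + X) ^ n`, and the alternating binomials are the coefficients of
the inverse of `(1 + X) ^ n`. -/
lemma sum_alternating_mul_choose {n : ℕ} (hn : 0 < n) {f g : ℕ → ℤ}
    (h : ∀ p, f p = ∑ x ∈ HasAntidiagonal.antidiagonal p, g x.1 * n.choose x.2) (p : ℕ) :
    ∑ k ∈ range (p + 1), (-1) ^ k * f (p - k) * ((n + k - 1).choose k : ℤ) = g p := by
  obtain ⟨d, rfl⟩ := Nat.exists_eq_succ_of_ne_zero hn.ne'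
  have hf : PowerSeries.mk f = PowerSeries.mk g * (1 + PowerSeries.X) ^ (d + 1) := by
    ext p
    rw [PowerSeries.coeff_mk, h, PowerSeries.coeff_mul]
    refine sum_congr rfl fun x _ => ?_
    have : ((1 + PowerSeries.X : PowerSeries ℤ)) ^ (d + 1)
        = (((1 + Polynomial.X : Polynomial ℤ) ^ (d + 1) : Polynomial ℤ) : PowerSeries ℤ) := by
      simp
    rw [PowerSeries.coeff_mk, this, Polynomial.coeff_coe, Polynomial.coeff_one_add_X_pow]
  -- Substituting `-X` turns the known inverse of `(1 - X) ^ (d + 1)` into that of `(1 + X) ^ (d +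
  -- 1)`.
  have hinv := congrArg (PowerSeries.rescale (-1 : ℤ))
    (PowerSeries.mk_add_choose_mul_one_sub_pow_eq_one ℤ d)
  rw [map_mul, map_pow, map_sub, map_one, PowerSeries.rescale_neg_one_X, sub_neg_eq_add,
    PowerSeries.rescale_mk] at hinv
  have hg := congrArg (PowerSeries.coeff p) (congrArg (· * PowerSeries.mk fun k =>
    (-1 : ℤ) ^ k * ((d + k).choose d : ℤ)) hf)
  simp only [mul_assoc] at hg
  rw [mul_comm ((1 + PowerSeries.X) ^ (d + 1)), hinv, mul_one, PowerSeries.coeff_mk, mul_comm,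
    PowerSeries.coeff_mul, Nat.sum_antidiagonal_eq_sum_range_succ_mk] at hg
  rw [← hg]
  refine sum_congr rfl fun k _ => ?_
  rw [PowerSeries.coeff_mk, PowerSeries.coeff_mk, Nat.succ_eq_add_one,
    show d + 1 + k - 1 = d + k by omega, Nat.choose_symm_add]
  ring

/-- Every upper index is less than `k`, so the convention for `binom` kills each term. -/
lemma firstSum_of_le {c B q : ℕ} (h : B ≤ c * q) (d : ℕ → ℕ → ℤ) (p : ℕ) :
    firstSum c B d p q = 0 := by
  refine sum_eq_zero fun k _ => ?_
  have h' : (B : ℤ) ≤ c * q := by exact_mod_cast h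
  rw [binom, if_neg (by linarith), mul_zero]

lemma sub_firstSum_of_lt {c B q : ℕ} (h : c * q < B) (d : ℕ → ℕ → ℤ) (p : ℕ) :
    d p q - firstSum c B d p q = ∑ k ∈ range (p + 1),
      (-1) ^ k * d (p - k) q * ((B - c * q + k - 1).choose k : ℤ) := by
  have h' : ((B - c * q : ℕ) : ℤ) = B - c * q := by push_cast [h.le]; ring
  have hsum : firstSum c B d p q = ∑ k ∈ range p, -((-1) ^ (k + 1) * d (p - (k + 1)) q *
      ((B - c * q + (k + 1) - 1).choose (k + 1) : ℤ)) := by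
    rw [firstSum, ← Ico_add_one_right_eq_Icc, sum_Ico_eq_sum_range, Nat.add_sub_cancel]
    refine sum_congr rfl fun k _ => ?_
    have e : (B : ℤ) - c * q + (1 + k : ℕ) - 1 = (B - c * q + (k + 1) - 1 : ℕ) := by
      rw [← h']; omega
    rw [e, add_comm 1 k, binom, if_pos (by omega), Int.toNat_natCast, Nat.add_sub_cancel]
    ring
  rw [sum_range_succ', hsum, sum_neg_distrib]
  simp
  ring

/-- Along each row the counts differ from the first sum by a nonnegative amount, which vanishes
on one side of the diagonal. -/
lemma firstSum_compatCount {N : ℕ} [NeZero N] {b c : ℕ} (hc : 0 < c)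
    {H V : Finset (ZMod N)} (hHV : Disjoint H V) (hbal : Balanced H V) (hV : 0 < #V) {p q : ℕ}
    (hpq : (p, q) ≠ (0, 0)) :
    firstSum c #V (fun p q => compatCount b c H V p q) p q ≤ compatCount b c H V p q ∧
    (c * #H * q ≤ b * #V * p →
      (compatCount b c H V p q : ℤ) = firstSum c #V (fun p q => compatCount b c H V p q) p q) := by
  classical
  rcases le_or_gt #V (c * q) with h | h
  · rw [firstSum_of_le h]
    refine ⟨by positivity, fun hle => ?_⟩
    rw [Nat.cast_eq_zero, compatCount, card_eq_zero, filter_eq_empty_iff]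
    rintro ⟨S, T⟩ hST hC
    simp only [mem_product, mem_powersetCard] at hST hC
    obtain ⟨⟨hSH, rfl⟩, hTV, rfl⟩ := hST
    -- At equality the shadow is all of `V`; beyond it the drift is positive. Each case has its own
    -- inequality contradicting `hle`.
    rcases h.eq_or_lt with h | h
    · have hsh : shadow c V S = V := by
        have := card_sdiff_shadow (disjoint_of_subset_left hSH hHV) h.ge
        rw [h, Nat.sub_self, card_eq_zero, sdiff_eq_empty_iff_subset] at this
        exact (shadow_subset c V S).antisymm this
      have hS : S.Nonempty := by
        rw [nonempty_iff_ne_empty]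
        rintro rfl
        simp at h
        simp [h] at hV
      have := hC.card_mul_lt_of_drift_nonpos hc hHV hbal hSH hS (by rwa [hsh]) h.ge
      omega
    · have h1 := hC.card_mul_lt_of_drift_pos hHV hSH hTV h
      have h2 : #V * (b * #T) < #V * #H := Nat.mul_lt_mul_of_pos_left h1 hV
      have h3 : #V * #H ≤ (c * #S) * #H := Nat.mul_le_mul_right _ h.le
      nlinarith
  · set G : ℕ → ℕ := fun p => ∑ S ∈ H.powersetCard q, fiberCount b c H V S (shadow c V S) p
      with hG
    have key : (compatCount b c H V p q : ℤ)
        - firstSum c #V (fun p q => compatCount b c H V p q) p q = G p := by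
      refine (sub_firstSum_of_lt h (fun p q => (compatCount b c H V p q : ℤ)) p).trans ?_
      refine sum_alternating_mul_choose (f := fun p => (compatCount b c H V p q : ℤ))
        (g := fun p => (G p : ℤ)) (by omega) (fun p => ?_) p
      rw [compatCount_eq_sum]
      simp only [hG]
      push_cast
      simp_rw [sum_mul]
      rw [sum_comm]
      refine sum_congr rfl fun S hS => ?_
      obtain ⟨hSH, rfl⟩ := mem_powersetCard.1 hS
      rw [fiberCount_eq_sum, card_sdiff_shadow (disjoint_of_subset_left hSH hHV) h.le]
      push_cast
      rfl
    refine ⟨by have : (0 : ℤ) ≤ G p := by positivity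
               linarith, fun hle => ?_⟩
    rw [← sub_eq_zero, key, Nat.cast_eq_zero]
    refine sum_eq_zero fun S hS => ?_
    rw [fiberCount, card_eq_zero, filter_eq_empty_iff]
    intro T hT hC
    obtain ⟨hSH, rfl⟩ := mem_powersetCard.1 hS
    obtain ⟨hTU, rfl⟩ := mem_powersetCard.1 hT
    have hS : S.Nonempty := by
      rw [nonempty_iff_ne_empty]
      rintro rfl
      have hT0 : T = ∅ := by
        rw [eq_empty_iff_forall_notMem]
        intro x hx
        obtain ⟨-, i, j, hij, -, hcov⟩ := mem_filter.1 (hTU hx)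
        have := hcov (i + 1) (by omega) (by omega)
        rw [height_succ, ind_of_notMem (notMem_empty _)] at this
        linarith [ind_nonneg V i]
      simp [hT0] at hpq
    have := hC.card_mul_lt_of_drift_nonpos hc hHV hbal hSH hS hTU h.le
    omega

lemma compatCount_zero {N : ℕ} [NeZero N] {b c : ℕ} {H V : Finset (ZMod N)} :
    compatCount b c H V 0 0 = 1 := by
  classical
  rw [compatCount, powersetCard_zero, powersetCard_zero, singleton_product_singleton,
    filter_true_of_mem, card_singleton]
  intro x hx
  rw [mem_singleton] at hx
  rintro i j hij ⟨h, -⟩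
  have := h (i + 1) (by omega) (by omega)
  rw [hx, height_succ, ind_of_notMem (notMem_empty _)] at this
  linarith [ind_nonneg V i]

lemma secondSum_eq_firstSum (b : ℕ) (a₁ : ℤ) (d : ℕ → ℕ → ℤ) (p q : ℕ) :
    secondSum b a₁ d p q = firstSum b a₁ (fun q p => d p q) q p := rfl

lemma secondSum_compatCount {N : ℕ} [NeZero N] {b c : ℕ} (hb : 0 < b)
    {H V : Finset (ZMod N)} (hHV : Disjoint H V) (hbal : Balanced H V) (hH : 0 < #H) {p q : ℕ}
    (hpq : (p, q) ≠ (0, 0)) :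
    secondSum b #H (fun p q => compatCount b c H V p q) p q ≤ compatCount b c H V p q ∧
    (b * #V * p ≤ c * #H * q →
      (compatCount b c H V p q : ℤ) = secondSum b #H (fun p q => compatCount b c H V p q) p q) := by
  have h := firstSum_compatCount (b := c) hb (disjoint_rev hHV) hbal.rev (by rwa [card_rev])
    (p := q) (q := p) (by simp only [ne_eq, Prod.mk.injEq] at hpq ⊢; tauto)
  simp only [compatCount_rev, card_rev] at h
  exact h

end Recurrence

/-! ### Existence of a balanced word. -/

section ChristoffelWord

open Finset

/-- There is a balanced cyclic word with any positive numbers of horizontal and vertical edges. -/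
lemma exists_balanced (A B : ℕ) (hA : 0 < A) (hB : 0 < B) :
    ∃ (N : ℕ) (_ : NeZero N) (H V : Finset (ZMod N)), Disjoint H V ∧ Balanced H V ∧ #H = A ∧ #V = B := by
  classical
  have : NeZero (A + B) := ⟨by omega⟩
  -- Vertical edges are those where adding `B` to the residue wraps around modulo `A + B`, so `cnt V
  -- n` is the floor of `n * B / (A + B)`.
  set V : Finset (ZMod (A + B)) := {x | A ≤ (x * (B : ZMod (A + B))).val} with hV
  have hNpos : (0 : ℤ) < A + B := by omega
  have hmem : ∀ l : ℤ, (l : ZMod (A + B)) ∈ V ↔ (A : ℤ) ≤ (l * B) % (A + B) := by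
    intro l
    rw [hV, mem_filter_univ, ← Nat.cast_le (α := ℤ)]
    have : ((l : ZMod (A + B)) * (B : ZMod (A + B))) = ((l * B : ℤ) : ZMod (A + B)) := by
      push_cast; rfl
    rw [this, ZMod.val_intCast]
    push_cast
    rfl
  have hcntV : ∀ n : ℤ, cnt V n = (n * B) / (A + B) := by
    refine eq_of_succ_eq (by simp [cnt_zero]) fun n => ?_
    have h1 := Int.emod_add_mul_ediv (n * B) (A + B)
    have h2 := Int.emod_add_mul_ediv ((n + 1) * B) (A + B)
    have h3 := Int.emod_nonneg (n * B) hNpos.ne'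
    have h4 := Int.emod_lt_of_pos (n * B) hNpos
    rw [cnt_succ, add_sub_cancel_left]
    by_cases h : (n : ZMod (A + B)) ∈ V
    · rw [ind_of_mem h]
      have h5 := (hmem n).1 h
      have : ((n + 1) * B : ℤ) / (A + B) = n * B / (A + B) + 1 := by
        rw [Int.ediv_eq_iff_of_pos hNpos]
        constructor <;> nlinarith
      linarith
    · rw [ind_of_notMem h]
      have h5 := not_le.1 (mt (hmem n).2 h)
      have : ((n + 1) * B : ℤ) / (A + B) = n * B / (A + B) := by
        rw [Int.ediv_eq_iff_of_pos hNpos]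
        constructor <;> nlinarith
      linarith
  have hcntH : ∀ n : ℤ, cnt Vᶜ n = n - cnt V n := by
    refine eq_of_succ_eq (by simp [cnt_zero]) fun n => ?_
    rw [cnt_succ, cnt_succ]
    by_cases h : (n : ZMod (A + B)) ∈ V
    · rw [ind_of_mem h, ind_of_notMem (by simpa using h)]; ring
    · rw [ind_of_notMem h, ind_of_mem (by simpa using h)]; ring
  have hcardV : #V = B := by
    have h := cnt_period V
    rw [hcntV] at h
    push_cast at h
    rw [Int.mul_ediv_cancel_left _ hNpos.ne'] at h
    exact_mod_cast h.symm
  have hcardH : #Vᶜ = A := by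
    rw [card_compl, ZMod.card, hcardV]; omega
  refine ⟨A + B, this, Vᶜ, V, disjoint_compl_left, ?_, hcardH, hcardV⟩
  intro i j hij hi hj
  rw [hcardV, hcardH, hcntH, hcntH, hcntV, hcntV]
  have hi' := not_le.1 (mt (hmem i).2 (by simpa using hi))
  have hj' := (hmem j).1 hj
  have h1 := Int.emod_add_mul_ediv (i * B) (A + B)
  have h2 := Int.emod_add_mul_ediv ((j + 1) * B) (A + B)
  have h3 := Int.emod_nonneg (i * B) hNpos.ne'
  have h4 := Int.emod_nonneg ((j + 1) * B) hNpos.ne'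
  -- `B` times the horizontal count minus `A` times the vertical count from `i` to `j + 1` is the
  -- residue at `j + 1` minus that at `i`. These lie in `[0, B)` and `[0, A)`, giving both bounds.
  have h5 : ((j + 1) * B : ℤ) % (A + B) < B := by
    have h6 := Int.emod_add_mul_ediv (j * B) (A + B)
    have h7 := Int.emod_lt_of_pos (j * B) hNpos
    have h8 : ((j + 1) * B : ℤ) / (A + B) = j * B / (A + B) + 1 := by
      rw [Int.ediv_eq_iff_of_pos hNpos]
      constructor <;> nlinarith
    rw [h8] at h2
    nlinarith
  constructor <;> nlinarith

end ChristoffelWord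

/-! ### Uniqueness for each rule, and the conclusion. -/

section Uniqueness

open Finset

lemma firstSum_congr {c : ℕ} {a₂ : ℤ} {d e : ℕ → ℕ → ℤ} {p q : ℕ}
    (h : ∀ p' < p, d p' q = e p' q) : firstSum c a₂ d p q = firstSum c a₂ e p q := by
  refine sum_congr rfl fun k hk => ?_
  rw [mem_Icc] at hk
  rw [h (p - k) (by omega)]

lemma secondSum_congr {b : ℕ} {a₁ : ℤ} {d e : ℕ → ℕ → ℤ} {p q : ℕ}
    (h : ∀ q' < q, d p q' = e p q') : secondSum b a₁ d p q = secondSum b a₁ e p q := by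
  rw [secondSum_eq_firstSum, secondSum_eq_firstSum]
  exact firstSum_congr (d := fun q p => d p q) (e := fun q p => e p q) h

lemma MaxRule.eq {b c : ℕ} {a₁ a₂ : ℤ} {d e : ℕ → ℕ → ℤ} (hd : MaxRule b c a₁ a₂ d)
    (he : MaxRule b c a₁ a₂ e) (h0 : d 0 0 = e 0 0) : d = e := by
  suffices ∀ n p q, p + q = n → d p q = e p q from funext fun p => funext fun q => this _ p q rfl
  intro n
  induction n using Nat.strong_induction_on with
  | _ n ih =>
    rintro p q rfl
    by_cases hpq : (p, q) = (0, 0)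
    · simp only [Prod.mk.injEq] at hpq
      rw [hpq.1, hpq.2, h0]
    · rw [hd p q hpq, he p q hpq,
        firstSum_congr fun p' h => ih (p' + q) (by omega) p' q rfl,
        secondSum_congr fun q' h => ih (p + q') (by omega) p q' rfl]

lemma LinearRule.eq {b c : ℕ} {a₁ a₂ : ℤ} {d e : ℕ → ℕ → ℤ} (hd : LinearRule b c a₁ a₂ d)
    (he : LinearRule b c a₁ a₂ e) (h0 : d 0 0 = e 0 0) : d = e := by
  suffices ∀ n p q, p + q = n → d p q = e p q from funext fun p => funext fun q => this _ p q rfl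
  intro n
  induction n using Nat.strong_induction_on with
  | _ n ih =>
    rintro p q rfl
    by_cases hpq : (p, q) = (0, 0)
    · simp only [Prod.mk.injEq] at hpq
      rw [hpq.1, hpq.2, h0]
    · rcases le_total ((c : ℤ) * a₁ * (q : ℤ)) ((b : ℤ) * a₂ * (p : ℤ)) with h | h
      · rw [(hd p q hpq).1 h, (he p q hpq).1 h,
          firstSum_congr fun p' h => ih (p' + q) (by omega) p' q rfl]
      · rw [(hd p q hpq).2 h, (he p q hpq).2 h,
          secondSum_congr fun q' h => ih (p + q') (by omega) p q' rfl]

end Uniqueness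

/-- There is a family which satisfies both rules. -/
lemma exists_linearRule_maxRule {b c : ℕ} (hb : 0 < b) (hc : 0 < c) {A B : ℕ} (hA : 0 < A)
    (hB : 0 < B) : ∃ e : ℕ → ℕ → ℤ, e 0 0 = 1 ∧ LinearRule b c A B e ∧ MaxRule b c A B e := by
  obtain ⟨N, _, H, V, hHV, hbal, rfl, rfl⟩ := exists_balanced A B hA hB
  have hlin : LinearRule b c H.card V.card (fun p q => compatCount b c H V p q) :=
    fun p q hpq => ⟨fun h => (firstSum_compatCount hc hHV hbal hB hpq).2 (by exact_mod_cast h),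
      fun h => (secondSum_compatCount hb hHV hbal hA hpq).2 (by exact_mod_cast h)⟩
  refine ⟨fun p q => compatCount b c H V p q, by simp [compatCount_zero], hlin,
    fun p q hpq => le_antisymm ?_ (max_le (firstSum_compatCount hc hHV hbal hB hpq).1
      (secondSum_compatCount hb hHV hbal hA hpq).1)⟩
  rcases le_total ((c : ℤ) * H.card * (q : ℤ)) ((b : ℤ) * V.card * (p : ℤ)) with h | h
  · exact ((hlin p q hpq).1 h).le.trans (le_max_left _ _)
  · exact ((hlin p q hpq).2 h).le.trans (le_max_right _ _)

end Greedy

theorem proposition1p6 (b c : ℕ) (hb : 0 < b) (hc : 0 < c)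
    (a₁ a₂ : ℤ) (ha₁ : 0 < a₁) (ha₂ : 0 < a₂)
    (d : ℕ → ℕ → ℤ) (hd : d 0 0 = 1) :
    Greedy.MaxRule b c a₁ a₂ d ↔ Greedy.LinearRule b c a₁ a₂ d := by
  lift a₁ to ℕ using ha₁.le
  lift a₂ to ℕ using ha₂.le
  obtain ⟨e, he0, hlin, hmax⟩ := Greedy.exists_linearRule_maxRule hb hc
    (Nat.cast_pos.1 ha₁) (Nat.cast_pos.1 ha₂)
  constructor
  · intro h
    rwa [h.eq hmax (hd.trans he0.symm)]
  · intro h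
    rwa [h.eq hlin (hd.trans he0.symm)]
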